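/- Let $\mathbb S^3=\{\mathbf x\in\mathbb R^4:\|\mathbf x\|=1\}$, oriented so that (outward normal, positive basis of the tangent space) is a positive basis of $\mathbb R^4$. Let $(K_+)_j$, $j=1,2,3$, be the tangent vector fields $$(K_+)_1=(-\mathbf x^4,-\mathbf x^3,\mathbf x^2,\mathbf x^1),\quad (K_+)_2=(\mathbf x^3,-\mathbf x^4,-\mathbf x^1,\mathbf x^2),\quad (K_+)_3=(-\mathbf x^2,\mathbf x^1,-\mathbf x^4,\mathbf x^3),$$ which are orthonormal for the standard metric; let $(K_+)^j$ be the dual covector fields and let $(L_+)_j=(K_+)_j{}^\alpha\,\partial/\partial y^\alpha$ be the corresponding derivations. Let $s^1,s^2,s^3$ be the Pauli matrices. For a Riemannian metric $g$ on $\mathbb S^3$ and a positively oriented $g$-orthonormal frame $e_1,e_2,e_3$, the (massless) Dirac operator acts on smooth spinor fields $v:\mathbb S^3\to\mathbb C^2$ and is given in local coordinates $y^\alpha$ by $$W=-i\sigma^\alpha\Bigl(\frac{\partial}{\partial y^\alpha}+\frac14\sigma_\beta\Bigl(\frac{\partial\sigma^\beta}{\partial y^\alpha}+\Gamma^\beta{}_{\alpha\gamma}\,\sigma^\gamma\Bigr)\Bigr),\qquad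 \sigma^\alpha=s^je_j{}^\alpha,\quad \sigma_\beta=g_{\beta\alpha}\sigma^\alpha,$$ where $\Gamma^\beta{}_{\alpha\gamma}$ are the Christoffel symbols of $g$. Let $a_1,a_2,a_3>0$ and let $g=\sum_{j=1}^3a_j^2\,(K_+)^j\otimes(K_+)^j$ be the generalized Berger metric. Then the vector fields $e_j=\frac1{a_j}(K_+)_j$ form a positively oriented $g$-orthonormal frame. The Dirac operator $W$ of $g$ written with respect to this frame (its value at a point does not depend on the local coordinates used) has the following properties. 1. For all smooth spinor fields, $$W=-i\sum_{j=1}^3\frac1{a_j}s^j(L_+)_j+\nu I,\qquad \nu=\frac{a_1^2+a_2^2+a_3^2}{2a_1a_2a_3}.$$ 2. $\nu$ is an eigenvalue of $W$: every nonzero constant spinor is an eigenspinor for $\nu$. 3. $W$ maps spinor fields that are linear in the Cartesian coordinates, $v_p(\mathbf x)=\sum_{i=1}^4c_{ip}\,\mathbf x^i$ with $c_{ip}\in\mathbb C$, $p=1,2$, to spinor fields of the same form. Its action on the eight coefficients $c_{ip}$ is given by an $8\times8$ Hermitian matrix whose characteristic polynomial is the square of the monic polynomial of degree four with the roots (repeated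 if they coincide) $$\nu-\frac1{a_1}-\frac1{a_2}-\frac1{a_3},\quad \nu-\frac1{a_1}+\frac1{a_2}+\frac1{a_3},\quad \nu+\frac1{a_1}-\frac1{a_2}+\frac1{a_3},\quad \nu+\frac1{a_1}+\frac1{a_2}-\frac1{a_3}.$$ In particular, the eigenvalues of $W$ that have an eigenspinor linear in the Cartesian coordinates are exactly these four numbers. -/

import Mathlib

open scoped Manifold ContDiff Matrix

noncomputable section

namespace Berger

/-- Euclidean `ℝ³`, where local coordinates `y = (y¹, y², y³)` take their values. -/
abbrev E3 : Type := EuclideanSpace ℝ (Fin 3)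

/-- Euclidean `ℝ⁴`, with Cartesian coordinates `x 0, x 1, x 2, x 3`. -/
abbrev E4 : Type := EuclideanSpace ℝ (Fin 4)

/-- The unit sphere `S³` in `ℝ⁴`. -/
abbrev S3 : Type := Metric.sphere (0 : E4) 1

/-- Two-columns of complex numbers. -/
abbrev Spin2 : Type := Fin 2 → ℂ

/-- Spinor fields on `S³`: two-columns of complex-valued functions. -/
abbrev SpinorField : Type := S3 → Spin2

/-- Smoothness of a spinor field (as a map from the manifold `S³`). -/
def SmoothSpinor (v : SpinorField) : Prop :=
  ContMDiff (𝓡 3) 𝓘(ℝ, Spin2) ∞ v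

/-- The Pauli matrices `s¹, s², s³`. -/
def pauli : Fin 3 → Matrix (Fin 2) (Fin 2) ℂ :=
  ![!![0, 1; 1, 0], !![0, -Complex.I; Complex.I, 0], !![1, 0; 0, -1]]

/-! ### Local coordinates -/

/-- `φ : U → S³` is the inverse of a smooth local coordinate system on `S³`. -/
structure IsLocalCoords (U : Set E3) (φ : E3 → S3) : Prop where
  isOpen : IsOpen U
  smooth : ContDiffOn ℝ ∞ (fun y => (φ y : E4)) U
  injOn : Set.InjOn φ U
  immersion : ∀ y ∈ U, Function.Injective (fderiv ℝ (fun z => (φ z : E4)) y)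

/-- The partial derivative `∂f/∂y^α`. -/
def pd {F : Type*} [NormedAddCommGroup F] [NormedSpace ℝ F]
    (α : Fin 3) (f : E3 → F) (y : E3) : F :=
  fderiv ℝ f y (EuclideanSpace.single α 1)

/-- The coordinate vector field `∂/∂y^α`, as a tangent vector to `S³` in `ℝ⁴`. -/
def coordVec (φ : E3 → S3) (α : Fin 3) (y : E3) : E4 :=
  pd α (fun z => (φ z : E4)) y

/-- Vector fields on `S³` (tangency is proved where it matters). -/
abbrev VField : Type := S3 → E4

/-- Fields of bilinear forms on the tangent spaces of `S³`. A tangent space is a subspace of `ℝ⁴`;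
only the values on tangent vectors are relevant. -/
abbrev Metric2 : Type := S3 → E4 → E4 → ℝ

/-- The Euclidean Gram matrix of the coordinate vector fields. -/
def gram (φ : E3 → S3) (y : E3) : Matrix (Fin 3) (Fin 3) ℝ :=
  Matrix.of fun α β => inner ℝ (coordVec φ α y) (coordVec φ β y)

/-- The components `X^α` of a tangent vector field `X` in local coordinates, that is, the unique
solution of `X = ∑ α, X^α ∂/∂y^α` (see `vecComp_eq_of_sum`). -/
def vecComp (φ : E3 → S3) (X : VField) (α : Fin 3) (y : E3) : ℝ :=
  ∑ β, (gram φ y)⁻¹ α β * inner ℝ (coordVec φ β y) (X (φ y))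

/-- The components `g_{αβ}` of a metric in local coordinates. -/
def metricComp (g : Metric2) (φ : E3 → S3) (α β : Fin 3) (y : E3) : ℝ :=
  g (φ y) (coordVec φ α y) (coordVec φ β y)

/-- The components `g^{αβ}` of the inverse metric. -/
def invMetricComp (g : Metric2) (φ : E3 → S3) (α β : Fin 3) (y : E3) : ℝ :=
  (Matrix.of fun γ δ => metricComp g φ γ δ y)⁻¹ α β

/-- The Christoffel symbols
`Γ^β_{αγ} = ½ g^{βδ} (∂_α g_{γδ} + ∂_γ g_{αδ} - ∂_δ g_{αγ})`. -/
def christoffel (g : Metric2) (φ : E3 → S3) (β α γ : Fin 3) (y : E3) : ℝ :=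
  1 / 2 * ∑ δ, invMetricComp g φ β δ y *
    (pd α (metricComp g φ γ δ) y + pd γ (metricComp g φ α δ) y - pd δ (metricComp g φ α γ) y)

/-! ### The Dirac operator -/

/-- `σ^α = s^j e_j^α`. -/
def sigmaUp (φ : E3 → S3) (e : Fin 3 → VField) (α : Fin 3) (y : E3) :
    Matrix (Fin 2) (Fin 2) ℂ :=
  ∑ j, (vecComp φ (e j) α y : ℂ) • pauli j

/-- `σ_β = g_{βα} σ^α`. -/
def sigmaDown (g : Metric2) (φ : E3 → S3) (e : Fin 3 → VField) (β : Fin 3) (y : E3) :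
    Matrix (Fin 2) (Fin 2) ℂ :=
  ∑ α, (metricComp g φ β α y : ℂ) • sigmaUp φ e α y

/-- `∂σ^β/∂y^α`, entry by entry. -/
def pdSigma (φ : E3 → S3) (e : Fin 3 → VField) (α β : Fin 3) (y : E3) :
    Matrix (Fin 2) (Fin 2) ℂ :=
  Matrix.of fun p q => pd α (fun z => sigmaUp φ e β z p q) y

/-- The massless Dirac operator for the metric `g` and the orthonormal frame `e`, written in the
local coordinates `φ⁻¹` and evaluated at the point with coordinates `y`:
`W v = -i σ^α (∂_α v + ¼ σ_β (∂_α σ^β + Γ^β_{αγ} σ^γ) v)`. -/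
def diracIn (g : Metric2) (e : Fin 3 → VField) (φ : E3 → S3) (v : SpinorField) (y : E3) :
    Spin2 :=
  (-Complex.I) • ∑ α, sigmaUp φ e α y *ᵥ
    (pd α (fun z => v (φ z)) y +
      (1 / 4 : ℂ) • ((∑ β, sigmaDown g φ e β y *
        (pdSigma φ e α β y + ∑ γ, (christoffel g φ β α γ y : ℂ) • sigmaUp φ e γ y)) *ᵥ
          v (φ y)))

/-- The massless Dirac operator on `S³` for the metric `g` and the orthonormal frame `e`: its value
at `x` is computed in a coordinate chart around `x`. -/
def dirac (g : Metric2) (e : Fin 3 → VField) (v : SpinorField) : SpinorField :=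
  fun x => diracIn g e (chartAt E3 x).symm v (chartAt E3 x x)

/-- The derivative `X^α ∂v/∂y^α` of a spinor field along a vector field, in local coordinates. -/
def lieIn (X : VField) (φ : E3 → S3) (v : SpinorField) (y : E3) : Spin2 :=
  ∑ α, vecComp φ X α y • pd α (fun z => v (φ z)) y

/-- The derivative of a spinor field along a vector field on `S³`; its value at `x` is computed in
a coordinate chart around `x`. -/
def lie (X : VField) (v : SpinorField) : SpinorField :=
  fun x => lieIn X (chartAt E3 x).symm v (chartAt E3 x x)

/-- `v` is an eigenspinor of the operator `W` for the eigenvalue `μ`. -/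
def IsEigenspinor (W : SpinorField → SpinorField) (μ : ℂ) (v : SpinorField) : Prop :=
  SmoothSpinor v ∧ v ≠ 0 ∧ W v = μ • v

/-- `e` is an orthonormal frame of tangent vector fields on `S³` with metric `g`. -/
def IsOrthonormalFrame (g : Metric2) (e : Fin 3 → VField) : Prop :=
  (∀ j (x : S3), inner ℝ (x : E4) (e j x) = 0) ∧
    ∀ j k (x : S3), g x (e j x) (e k x) = if j = k then 1 else 0

/-- `e` is positively oriented: `(outward normal, e₁, e₂, e₃)` is a positive basis of `ℝ⁴`. This is
the orientation of `S³` in which the spherical coordinates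
`x = (cos y¹, sin y¹ cos y², sin y¹ sin y² cos y³, sin y¹ sin y² sin y³)` are positive. -/
def IsPositiveFrame (e : Fin 3 → VField) : Prop :=
  ∀ x : S3, 0 < (Matrix.of ![fun i => (x : E4) i, fun i => e 0 x i, fun i => e 1 x i,
    fun i => e 2 x i]).det

/-! ### Generalized Berger spheres -/

/-- The special Killing vector fields `(K₊)_j` on `S³`. -/
def K : Fin 3 → VField :=
  ![fun x => !₂[-(x : E4) 3, -(x : E4) 2, (x : E4) 1, (x : E4) 0],
    fun x => !₂[(x : E4) 2, -(x : E4) 3, -(x : E4) 0, (x : E4) 1],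
    fun x => !₂[-(x : E4) 1, (x : E4) 0, -(x : E4) 3, (x : E4) 2]]

/-- The covector fields `(K₊)^j` dual to `(K₊)_j`, obtained by lowering the index by means of the
standard metric of `S³`. -/
def coK (j : Fin 3) (x : S3) (u : E4) : ℝ := inner ℝ (K j x) u

/-- The operators `(L₊)_j = (K₊)_j^α ∂/∂y^α`. -/
def L (j : Fin 3) (v : SpinorField) : SpinorField := lie (K j) v

/-- The generalized Berger metric `∑ j, a_j² (K₊)^j ⊗ (K₊)^j`. -/
def bergerMetric (a : Fin 3 → ℝ) : Metric2 :=
  fun x u w => ∑ j, a j ^ 2 * coK j x u * coK j x w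

/-- The frame `e_j = (1/a_j) (K₊)_j` (the symmetric gauge: the coefficients of `e` with respect to
the `(K₊)_k` form the positive symmetric matrix `diag (1/a_j)`). -/
def bergerFrame (a : Fin 3 → ℝ) : Fin 3 → VField :=
  fun j x => (1 / a j) • K j x

/-- The Dirac operator of the generalized Berger sphere. -/
def bergerDirac (a : Fin 3 → ℝ) : SpinorField → SpinorField :=
  dirac (bergerMetric a) (bergerFrame a)

/-- `ν = (a₁² + a₂² + a₃²) / (2 a₁ a₂ a₃)`. -/
def nu (a : Fin 3 → ℝ) : ℝ :=
  (a 0 ^ 2 + a 1 ^ 2 + a 2 ^ 2) / (2 * a 0 * a 1 * a 2)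

/-- The numbers `ν - 1/a₁ - 1/a₂ - 1/a₃`, `ν - 1/a₁ + 1/a₂ + 1/a₃`, `ν + 1/a₁ - 1/a₂ + 1/a₃`,
`ν + 1/a₁ + 1/a₂ - 1/a₃`. -/
def linEigenvalue (a : Fin 3 → ℝ) : Fin 4 → ℝ :=
  ![nu a - 1 / a 0 - 1 / a 1 - 1 / a 2,
    nu a - 1 / a 0 + 1 / a 1 + 1 / a 2,
    nu a + 1 / a 0 - 1 / a 1 + 1 / a 2,
    nu a + 1 / a 0 + 1 / a 1 - 1 / a 2]

/-- The spinor field that is linear in the Cartesian coordinates, with the eight complex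
coefficients `c (i, p)`: its `p`-th component is `∑ i, c (i, p) x^i`. -/
def linSpinor (c : Fin 4 × Fin 2 → ℂ) : SpinorField :=
  fun x p => ∑ i, c (i, p) * (((x : E4) i : ℝ) : ℂ)

/-- The components `X^α` are the coefficients of `X` in the basis `∂/∂y^α`. -/
theorem vecComp_eq_of_sum (φ : E3 → S3) (X : VField) (y : E3) (c : Fin 3 → ℝ)
    (hli : LinearIndependent ℝ fun α => coordVec φ α y)
    (hX : X (φ y) = ∑ α, c α • coordVec φ α y) (α : Fin 3) :
    vecComp φ X α y = c α := by
  have hdet : IsUnit (gram φ y).det := by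
    rw [← Matrix.isUnit_iff_isUnit_det]
    exact (Matrix.posDef_gram_of_linearIndependent (𝕜 := ℝ) hli).isUnit
  have h : (fun β => inner ℝ (coordVec φ β y) (X (φ y))) = gram φ y *ᵥ c := by
    funext β
    simp [hX, inner_sum, inner_smul_right, gram, Matrix.mulVec, dotProduct, mul_comm]
  have h2 : vecComp φ X α y = ((gram φ y)⁻¹ *ᵥ (gram φ y *ᵥ c)) α := by
    rw [← h]; rfl
  rw [h2, Matrix.mulVec_mulVec, Matrix.nonsing_inv_mul _ hdet, Matrix.one_mulVec]

end Berger

end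

noncomputable section

namespace Berger

/-! ### Stereographic charts and ambient extensions -/

/-! The fields `K j` are restrictions of linear maps of ℝ⁴ that are skew, satisfy the quaternion
relations, and together with x form an orthonormal basis of ℝ⁴ at each x of the sphere. Their dual
coframe θ therefore obeys the Maurer–Cartan equations dθ^j(K_p, K_m) = 2 ε_{jpm}, with constant
coefficients (`sum_pd_theta_sub`). For a metric that is diagonal with constant entries in this
frame, the Koszul formula then gives constant connection coefficients, proportional to ε_{jpm}
(`frame_connection`). So the zero-order term of W involves only products of three distinct Pauli
matrices, which are ±i times the identity, and it collapses to the scalar ν (`sum_eps_pauli`,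
`sum_sigma_connection`).

The computation is made in arbitrary coordinates, with θ^j_α and K_j^α as inverse matrices. The
first-order part depends only on the derivatives along `K j`, which are ambient derivatives in ℝ⁴
(`lieIn_K_eq`). This gives independence of coordinates, and constants are visibly eigenspinors.

On linear spinors, W becomes ν + ∑ b_j S_j with b_j = 1/a_j and S_j = i K_j ⊗ s_j. The S_j are
commuting Hermitian involutions with S₁S₂S₃ = -1, so their joint eigenvalues are the four sign
triples with product -1, each with multiplicity two. One matrix, independent of the a_j,
diagonalizes all cases (`linMatrix_mul_eigMatrix`). -/

theorem chart_target (x : S3) : (chartAt E3 x).target = Set.univ :=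
  have : Fact (Module.finrank ℝ E4 = 3 + 1) := ⟨finrank_euclideanSpace_fin⟩
  stereographic'_target (n := 3) (-x)

theorem contDiff_chart_symm (x : S3) :
    ContDiff ℝ ∞ fun y => ((chartAt E3 x).symm y : E4) := by
  have : Fact (Module.finrank ℝ E4 = 3 + 1) := ⟨finrank_euclideanSpace_fin⟩
  let U := (OrthonormalBasis.fromOrthogonalSpanSingleton (𝕜 := ℝ) 3
    (ne_zero_of_mem_unit_sphere (-x))).repr
  exact (contDiff_stereoInvFunAux (m := ∞) (v := (-x : S3).val) |>.comp
    (ℝ ∙ ((-x : S3) : E4))ᗮ.subtypeL.contDiff).comp U.symm.contDiff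

/-- A stereographic chart extends differentiably to a neighbourhood of its domain in `ℝ⁴`. -/
theorem exists_ambient_chart (x : S3) :
    ∃ R : E4 → E3, (∀ q : S3, chartAt E3 x q = R q) ∧
      ∀ q ∈ (chartAt E3 x).source, DifferentiableAt ℝ R (q : E4) := by
  have : Fact (Module.finrank ℝ E4 = 3 + 1) := ⟨finrank_euclideanSpace_fin⟩
  let U := (OrthonormalBasis.fromOrthogonalSpanSingleton (𝕜 := ℝ) 3
    (ne_zero_of_mem_unit_sphere (-x))).repr
  -- The formula for stereographic projection makes sense on ℝ⁴ and is smooth off the hyperplane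
  -- ⟨-x, p⟩ = 1, which meets the sphere only at the pole -x.
  refine ⟨fun p => U (stereoToFun ((-x : S3) : E4) p), fun q => rfl, fun q hq => ?_⟩
  have hq' : q ∈ (stereographic' 3 (-x)).source := hq
  have hne : innerSL ℝ ((-x : S3) : E4) (q : E4) ≠ 1 := by
    rw [stereographic'_source, Set.mem_compl_singleton_iff] at hq'
    intro h
    exact hq' ((sphere_ext_iff _ _).2 (by rw [real_inner_comm]; exact h))
  have hopen : IsOpen {p : E4 | innerSL ℝ ((-x : S3) : E4) p ≠ 1} :=
    isOpen_ne_fun (by fun_prop) (by fun_prop)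
  have h1 : DifferentiableAt ℝ (stereoToFun ((-x : S3) : E4)) (q : E4) :=
    ((contDiffOn_stereoToFun (n := 1)).contDiffAt (hopen.mem_nhds hne)).differentiableAt
      one_ne_zero
  exact U.toContinuousLinearEquiv.differentiableAt.comp _ h1

/-- The ambient extension of the chart is a differentiable left inverse of the parametrization, so
the chain rule makes the derivative injective. -/
theorem isLocalCoords_chart (x : S3) :
    IsLocalCoords Set.univ (chartAt E3 x).symm where
  isOpen := isOpen_univ
  smooth := (contDiff_chart_symm x).contDiffOn
  injOn := by
    rw [← chart_target x]
    exact (chartAt E3 x).symm.injOn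
  immersion := fun y _ => by
    obtain ⟨R, hR, hd⟩ := exists_ambient_chart x
    have hy : y ∈ (chartAt E3 x).target := by simp [chart_target]
    have hf := ((contDiff_chart_symm x).differentiable (by simp) y).hasFDerivAt
    have hc := (hd _ ((chartAt E3 x).map_target hy)).hasFDerivAt.comp y hf
    have hid : (R ∘ fun z => ((chartAt E3 x).symm z : E4)) = id := by
      funext z
      have hz : z ∈ (chartAt E3 x).target := by simp [chart_target]
      simp only [Function.comp, ← hR, (chartAt E3 x).right_inv hz, id]
    rw [hid] at hc
    have h := hc.unique (hasFDerivAt_id y)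
    intro u w huw
    have hu := DFunLike.congr_fun h u
    have hw := DFunLike.congr_fun h w
    simp only [ContinuousLinearMap.comp_apply, ContinuousLinearMap.id_apply] at hu hw
    rw [← hu, ← hw, huw]

/-- A smooth spinor field is near each point the restriction of a function on `ℝ⁴` that is
differentiable at this point. -/
theorem SmoothSpinor.exists_ambient {v : SpinorField} (hv : SmoothSpinor v) (x : S3) :
    ∃ V : E4 → Spin2, DifferentiableAt ℝ V (x : E4) ∧ ∀ᶠ q in nhds x, v q = V (q : E4) := by
  obtain ⟨R, hR, hd⟩ := exists_ambient_chart x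
  have hx := mem_chart_source E3 x
  have hs : ContDiff ℝ ∞ (fun y => v ((chartAt E3 x).symm y)) := by
    rw [← contMDiff_iff_contDiff, ← contMDiffOn_univ, ← chart_target x]
    exact ContMDiff.comp_contMDiffOn hv (contMDiffOn_chart_symm (I := 𝓡 3))
  refine ⟨fun p => v ((chartAt E3 x).symm (R p)), ?_, ?_⟩
  · exact (hs.differentiable (by simp) (R x)).comp (x : E4) (hd x hx)
  · filter_upwards [(chartAt E3 x).open_source.mem_nhds hx] with q hq
    rw [← hR, (chartAt E3 x).left_inv hq]

/-! ### Immersed coordinates and the fields `K` -/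

/-- The linear vector fields on `ℝ⁴` that restrict to the fields `K j`. -/
def linK (j : Fin 3) : E4 →L[ℝ] E4 :=
  LinearMap.toContinuousLinearMap
    ((![⟨⟨fun x => !₂[-x 3, -x 2, x 1, x 0], fun x y => by
            ext i; fin_cases i <;> simp <;> ring⟩,
          fun c x => by ext i; fin_cases i <;> simp⟩,
        ⟨⟨fun x => !₂[x 2, -x 3, -x 0, x 1], fun x y => by
            ext i; fin_cases i <;> simp <;> ring⟩,
          fun c x => by ext i; fin_cases i <;> simp⟩,
        ⟨⟨fun x => !₂[-x 1, x 0, -x 3, x 2], fun x y => by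
            ext i; fin_cases i <;> simp <;> ring⟩,
          fun c x => by ext i; fin_cases i <;> simp⟩] : Fin 3 → E4 →ₗ[ℝ] E4) j)

theorem linK_zero_apply (x : E4) : linK 0 x = !₂[-x 3, -x 2, x 1, x 0] := rfl

theorem linK_one_apply (x : E4) : linK 1 x = !₂[x 2, -x 3, -x 0, x 1] := rfl

theorem linK_two_apply (x : E4) : linK 2 x = !₂[-x 1, x 0, -x 3, x 2] := rfl

theorem K_eq_linK (j : Fin 3) (x : S3) : K j x = linK j x := by
  fin_cases j <;> rfl

theorem inner_E4 (x y : E4) :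
    inner ℝ x y = x 0 * y 0 + x 1 * y 1 + x 2 * y 2 + x 3 * y 3 := by
  simp [PiLp.inner_apply, Fin.sum_univ_four, mul_comm]

theorem inner_linK_self (j : Fin 3) (x : E4) : inner ℝ x (linK j x) = 0 := by
  simp only [inner_E4]
  fin_cases j <;>
    simp [linK_zero_apply, linK_one_apply, linK_two_apply] <;> ring

theorem inner_linK_left (j : Fin 3) (x y : E4) :
    inner ℝ (linK j x) y = -inner ℝ (linK j y) x := by
  simp only [inner_E4]
  fin_cases j <;>
    simp [linK_zero_apply, linK_one_apply, linK_two_apply] <;> ring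

theorem inner_linK_linK (j k : Fin 3) (x : E4) :
    inner ℝ (linK j x) (linK k x) = if j = k then inner ℝ x x else 0 := by
  simp only [inner_E4]
  fin_cases j <;> fin_cases k <;>
    simp [linK_zero_apply, linK_one_apply, linK_two_apply] <;> ring

/-- The Levi-Civita symbol. -/
def eps (j k l : Fin 3) : ℝ :=
  ((j : ℝ) - (k : ℝ)) * ((k : ℝ) - (l : ℝ)) * ((l : ℝ) - (j : ℝ)) / 2

/-- The structure constants of the frame `K`. -/
theorem inner_linK_linK_linK (j k l : Fin 3) (x : E4) :
    inner ℝ (linK j (linK k x)) (linK l x) = eps j k l * inner ℝ x x := by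
  simp only [inner_E4]
  fin_cases j <;> fin_cases k <;> fin_cases l <;>
    simp [linK_zero_apply, linK_one_apply, linK_two_apply, eps] <;> ring

/-- Parseval's expansion in the orthogonal basis x, K₁x, K₂x, K₃x, scaled by |x|² so that it is a
polynomial identity. -/
theorem sum_inner_linK_smul (x u : E4) :
    ∑ k, inner ℝ (linK k x) u • linK k x = inner ℝ x x • u - inner ℝ x u • x := by
  simp only [inner_E4]
  ext i
  fin_cases i <;>
    simp [Fin.sum_univ_three, linK_zero_apply, linK_one_apply, linK_two_apply] <;> ring

theorem inner_S3_self (x : S3) : inner ℝ (x : E4) (x : E4) = 1 := by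
  simp

theorem inner_K_K (j k : Fin 3) (x : S3) :
    inner ℝ (K j x) (K k x) = if j = k then 1 else 0 := by
  rw [K_eq_linK, K_eq_linK, inner_linK_linK, inner_S3_self]

theorem sum_inner_K_smul (x : S3) {u : E4} (hu : inner ℝ (x : E4) u = 0) :
    ∑ k, inner ℝ (K k x) u • K k x = u := by
  simp only [K_eq_linK, sum_inner_linK_smul, inner_S3_self, hu]
  simp

/-- The components of the covector fields dual to `K` in local coordinates. -/
def theta (φ : E3 → S3) (j α : Fin 3) (z : E3) : ℝ :=
  inner ℝ (linK j (φ z)) (coordVec φ α z)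

theorem coK_coordVec (φ : E3 → S3) (j α : Fin 3) (z : E3) :
    coK j (φ z) (coordVec φ α z) = theta φ j α z := by
  rw [coK, K_eq_linK, theta]

/-! ### The coframe dual to `K` in local coordinates, and its Maurer–Cartan equations. -/

namespace IsLocalCoords

variable {U : Set E3} {φ : E3 → S3} {y : E3}

theorem contDiffAt (h : IsLocalCoords U φ) (hy : y ∈ U) :
    ContDiffAt ℝ ∞ (fun z => (φ z : E4)) y :=
  h.smooth.contDiffAt (h.isOpen.mem_nhds hy)

theorem differentiableAt (h : IsLocalCoords U φ) (hy : y ∈ U) :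
    DifferentiableAt ℝ (fun z => (φ z : E4)) y :=
  (h.contDiffAt hy).differentiableAt (by simp)

theorem differentiableAt_fderiv (h : IsLocalCoords U φ) (hy : y ∈ U) :
    DifferentiableAt ℝ (fderiv ℝ fun z => (φ z : E4)) y :=
  ((h.contDiffAt hy).fderiv_right (m := 1) (by norm_cast)).differentiableAt one_ne_zero

theorem differentiableAt_coordVec (h : IsLocalCoords U φ) (hy : y ∈ U) (α : Fin 3) :
    DifferentiableAt ℝ (coordVec φ α) y :=
  (h.differentiableAt_fderiv hy).clm_apply (differentiableAt_const _)

theorem pd_coordVec_comm (h : IsLocalCoords U φ) (hy : y ∈ U) (α γ : Fin 3) :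
    pd α (coordVec φ γ) y = pd γ (coordVec φ α) y := by
  have hs := (h.contDiffAt hy).isSymmSndFDerivAt (by simp only [minSmoothness_of_isRCLikeNormedField]; exact WithTop.coe_le_coe.2 le_top)
  have key (α γ : Fin 3) : pd α (coordVec φ γ) y =
      fderiv ℝ (fderiv ℝ fun z => (φ z : E4)) y (EuclideanSpace.single α 1)
        (EuclideanSpace.single γ 1) := by
    have := (h.differentiableAt_fderiv hy).hasFDerivAt.clm_apply
      (hasFDerivAt_const (EuclideanSpace.single γ (1 : ℝ)) y)
    rw [pd, show coordVec φ γ = fun z => fderiv ℝ (fun z => (φ z : E4)) z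
      (EuclideanSpace.single γ (1 : ℝ)) from rfl, this.fderiv]
    simp
  rw [key, key]
  exact hs _ _

/-- Differentiate |φ|² = 1. -/
theorem inner_coordVec (h : IsLocalCoords U φ) (hy : y ∈ U) (α : Fin 3) :
    inner ℝ (φ y : E4) (coordVec φ α y) = 0 := by
  have h1 := ((h.differentiableAt hy).hasFDerivAt.inner ℝ (h.differentiableAt hy).hasFDerivAt)
  have h2 : (fun z => inner ℝ (φ z : E4) (φ z : E4)) = fun _ => (1 : ℝ) := by
    funext z
    exact inner_S3_self _
  rw [h2] at h1
  have h3 := DFunLike.congr_fun (h1.unique (hasFDerivAt_const (1 : ℝ) y))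
    (EuclideanSpace.single α 1)
  simp only [ContinuousLinearMap.comp_apply, ContinuousLinearMap.prod_apply,
    fderivInnerCLM_apply, zero_apply] at h3
  rw [real_inner_comm (φ y : E4)] at h3
  simp only [coordVec, pd]
  linarith

theorem coordVec_eq_sum (h : IsLocalCoords U φ) (hy : y ∈ U) (α : Fin 3) :
    coordVec φ α y = ∑ k, theta φ k α y • K k (φ y) := by
  rw [← sum_inner_K_smul (φ y) (h.inner_coordVec hy α)]
  simp only [K_eq_linK, theta]

theorem linearIndependent_coordVec (h : IsLocalCoords U φ) (hy : y ∈ U) :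
    LinearIndependent ℝ fun α => coordVec φ α y := by
  rw [Fintype.linearIndependent_iff]
  intro c hc α
  have h1 : fderiv ℝ (fun z => (φ z : E4)) y (∑ α, c α • EuclideanSpace.single α (1 : ℝ)) =
      fderiv ℝ (fun z => (φ z : E4)) y 0 := by
    rw [map_sum, map_zero]
    refine Eq.trans (Finset.sum_congr rfl fun α _ => ?_) hc
    exact map_smul _ _ _
  have h2 := congrArg (fun u : E3 => u α) (h.immersion y hy h1)
  simpa [Pi.single_apply] using h2

/-- The matrix θ expresses the coordinate vectors in the basis `K`, so a kernel vector would be a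
linear relation between them. -/
theorem isUnit_det_theta (h : IsLocalCoords U φ) (hy : y ∈ U) :
    IsUnit (Matrix.of fun j α => theta φ j α y).det := by
  rw [← Matrix.isUnit_iff_isUnit_det, ← Matrix.mulVec_injective_iff_isUnit,
    ← Matrix.coe_mulVecLin, injective_iff_map_eq_zero]
  intro c hc
  have h1 : ∑ α, c α • coordVec φ α y = 0 := by
    simp only [h.coordVec_eq_sum hy, Finset.smul_sum, smul_smul]
    rw [Finset.sum_comm]
    simp only [← Finset.sum_smul]
    refine Finset.sum_eq_zero fun k _ => ?_
    have h2 := congrFun hc k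
    simp only [Matrix.mulVecLin_apply, Matrix.mulVec, dotProduct, Matrix.of_apply,
      Pi.zero_apply] at h2
    simp only [mul_comm (c _), h2, zero_smul]
  funext α
  exact Fintype.linearIndependent_iff.1 (h.linearIndependent_coordVec hy) c h1 α

/-- The components of `K` and those of the dual covector fields form inverse matrices. -/
theorem vecComp_K (h : IsLocalCoords U φ) (hy : y ∈ U) (j α : Fin 3) :
    vecComp φ (K j) α y = (Matrix.of fun j α => theta φ j α y)⁻¹ α j := by
  set T := Matrix.of fun j α => theta φ j α y with hT
  refine vecComp_eq_of_sum φ (K j) y (fun α => T⁻¹ α j) (h.linearIndependent_coordVec hy) ?_ α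
  have hu := Matrix.mul_nonsing_inv T (h.isUnit_det_theta hy)
  simp only [h.coordVec_eq_sum hy, Finset.smul_sum, smul_smul]
  rw [Finset.sum_comm]
  simp only [← Finset.sum_smul]
  have (k : Fin 3) : ∑ α, T⁻¹ α j * theta φ k α y = if k = j then 1 else 0 := by
    have := congrFun (congrFun hu k) j
    simp only [Matrix.mul_apply, Matrix.one_apply] at this
    rw [← this]
    exact Finset.sum_congr rfl fun α _ => mul_comm _ _
  simp [this]

theorem sum_theta_mul_vecComp (h : IsLocalCoords U φ) (hy : y ∈ U) (j m : Fin 3) :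
    ∑ α, theta φ j α y * vecComp φ (K m) α y = if j = m then 1 else 0 := by
  simp only [h.vecComp_K hy]
  have := congrFun (congrFun (Matrix.mul_nonsing_inv _ (h.isUnit_det_theta hy)) j) m
  simpa only [Matrix.mul_apply, Matrix.one_apply, Matrix.of_apply] using this

theorem sum_vecComp_smul_coordVec (h : IsLocalCoords U φ) (hy : y ∈ U) (m : Fin 3) :
    ∑ α, vecComp φ (K m) α y • coordVec φ α y = K m (φ y) := by
  simp only [h.coordVec_eq_sum hy, Finset.smul_sum, smul_smul]
  rw [Finset.sum_comm]
  simp only [← Finset.sum_smul, mul_comm (vecComp _ _ _ _), h.sum_theta_mul_vecComp hy]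
  simp

theorem differentiableAt_theta (h : IsLocalCoords U φ) (hy : y ∈ U) (j α : Fin 3) :
    DifferentiableAt ℝ (theta φ j α) y :=
  ((linK j).differentiableAt.comp y (h.differentiableAt hy)).inner ℝ
    (h.differentiableAt_coordVec hy α)

theorem pd_theta (h : IsLocalCoords U φ) (hy : y ∈ U) (j α γ : Fin 3) :
    pd α (theta φ j γ) y = inner ℝ (linK j (coordVec φ α y)) (coordVec φ γ y) +
      inner ℝ (linK j (φ y)) (pd α (coordVec φ γ) y) := by
  have h1 := ((linK j).hasFDerivAt.comp y (h.differentiableAt hy).hasFDerivAt).inner ℝ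
    (h.differentiableAt_coordVec hy γ).hasFDerivAt
  have h2 : pd α (theta φ j γ) y = _ :=
    DFunLike.congr_fun (HasFDerivAt.fderiv (f := theta φ j γ) h1) (EuclideanSpace.single α 1)
  rw [h2]
  simp only [ContinuousLinearMap.comp_apply, ContinuousLinearMap.prod_apply,
    fderivInnerCLM_apply, coordVec, pd, Function.comp]
  rw [add_comm]

/-- Second derivatives of φ cancel by symmetry; the two remaining terms coincide because `linK j` is
skew, whence the factor 2. -/
theorem pd_theta_sub (h : IsLocalCoords U φ) (hy : y ∈ U) (j α γ : Fin 3) :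
    pd α (theta φ j γ) y - pd γ (theta φ j α) y =
      2 * inner ℝ (linK j (coordVec φ α y)) (coordVec φ γ y) := by
  rw [h.pd_theta hy, h.pd_theta hy, h.pd_coordVec_comm hy γ α,
    inner_linK_left j (coordVec φ γ y)]
  ring

/-- The Maurer–Cartan equations of the coframe. -/
theorem sum_pd_theta_sub (h : IsLocalCoords U φ) (hy : y ∈ U) (j p m : Fin 3) :
    (∑ α, ∑ γ, vecComp φ (K p) α y * vecComp φ (K m) γ y * pd α (theta φ j γ) y) -
      ∑ α, ∑ γ, vecComp φ (K m) α y * vecComp φ (K p) γ y * pd α (theta φ j γ) y =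
    2 * eps j p m := by
  have h1 : 2 * eps j p m = ∑ α, ∑ γ, vecComp φ (K p) α y * vecComp φ (K m) γ y *
      (2 * inner ℝ (linK j (coordVec φ α y)) (coordVec φ γ y)) := by
    have := inner_linK_linK_linK j p m (φ y)
    rw [inner_S3_self, mul_one, ← K_eq_linK, ← K_eq_linK, ← h.sum_vecComp_smul_coordVec hy p,
      ← h.sum_vecComp_smul_coordVec hy m] at this
    rw [← this]
    simp only [map_sum, map_smul, sum_inner, inner_sum, inner_smul_left, inner_smul_right,
      Finset.mul_sum]
    rw [Finset.sum_comm]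
    refine Finset.sum_congr rfl fun α _ => Finset.sum_congr rfl fun γ _ => ?_
    simp only [conj_trivial]
    ring
  have h2 : ∑ α, ∑ γ, vecComp φ (K m) α y * vecComp φ (K p) γ y * pd α (theta φ j γ) y =
      ∑ α, ∑ γ, vecComp φ (K p) α y * vecComp φ (K m) γ y * pd γ (theta φ j α) y := by
    rw [Finset.sum_comm]
    refine Finset.sum_congr rfl fun α _ => Finset.sum_congr rfl fun γ _ => ?_
    ring
  rw [h1, h2]
  simp only [← Finset.sum_sub_distrib, ← h.pd_theta_sub hy]
  refine Finset.sum_congr rfl fun α _ => Finset.sum_congr rfl fun γ _ => ?_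
  ring

/-- Cramer's rule: near y the components are cofactors of θ divided by its nonvanishing determinant.
-/
theorem differentiableAt_vecComp_K (h : IsLocalCoords U φ) (hy : y ∈ U) (j α : Fin 3) :
    DifferentiableAt ℝ (vecComp φ (K j) α) y := by
  have h1 : vecComp φ (K j) α =ᶠ[nhds y]
      fun z => (Matrix.of fun j α => theta φ j α z)⁻¹ α j := by
    filter_upwards [h.isOpen.mem_nhds hy] with z hz using h.vecComp_K hz j α
  refine DifferentiableAt.congr_of_eventuallyEq ?_ h1
  have hd := (h.isUnit_det_theta hy).ne_zero
  have h2 := fun j α => h.differentiableAt_theta hy j α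
  simp only [Matrix.inv_def, Matrix.smul_apply, Ring.inverse_eq_inv', smul_eq_mul]
  simp only [Matrix.det_fin_three, Matrix.of_apply] at hd ⊢
  refine DifferentiableAt.mul (DifferentiableAt.inv (by fun_prop) hd) ?_
  fin_cases α <;> fin_cases j <;> simp [Matrix.adjugate_fin_three] <;> fun_prop

/-- The duality of θ and K holds on a neighbourhood of y and can be differentiated. This trades
derivatives of K for derivatives of θ. -/
theorem sum_theta_mul_pd_vecComp (h : IsLocalCoords U φ) (hy : y ∈ U) (j m α : Fin 3) :
    ∑ β, theta φ j β y * pd α (vecComp φ (K m) β) y =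
      -∑ β, pd α (theta φ j β) y * vecComp φ (K m) β y := by
  have h1 : (fun z => ∑ β, theta φ j β z * vecComp φ (K m) β z) =ᶠ[nhds y]
      fun _ => if j = m then 1 else 0 := by
    filter_upwards [h.isOpen.mem_nhds hy] with z hz using h.sum_theta_mul_vecComp hz j m
  have h2 := HasFDerivAt.fun_sum fun β (_ : β ∈ Finset.univ) =>
    (h.differentiableAt_theta hy j β).hasFDerivAt.mul
      (h.differentiableAt_vecComp_K hy m β).hasFDerivAt
  have h3 := DFunLike.congr_fun
    ((h2.congr_of_eventuallyEq h1.symm).unique (hasFDerivAt_const _ y))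
    (EuclideanSpace.single α 1)
  simp only [sum_apply, add_apply,
    smul_apply, smul_eq_mul, zero_apply,
    Finset.sum_add_distrib] at h3
  rw [eq_neg_iff_add_eq_zero, ← h3]
  congr 1
  exact Finset.sum_congr rfl fun β _ => mul_comm _ _

/-- The derivative along a tangent field does not depend on the local coordinates. -/
theorem lieIn_K_eq (h : IsLocalCoords U φ) (hy : y ∈ U) (j : Fin 3) {v : SpinorField}
    {V : E4 → Spin2} (hV : DifferentiableAt ℝ V (φ y : E4))
    (hvV : ∀ᶠ q in nhds (φ y), v q = V (q : E4)) :
    lieIn (K j) φ v y = fderiv ℝ V (φ y : E4) (K j (φ y)) := by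
  have hc : ContinuousAt φ y :=
    Topology.IsInducing.subtypeVal.continuousAt_iff.2 (h.differentiableAt hy).continuousAt
  have h1 : (fun z => v (φ z)) =ᶠ[nhds y] fun z => V (φ z : E4) := hc.eventually hvV
  have h2 := hV.hasFDerivAt.comp y (h.differentiableAt hy).hasFDerivAt
  have h3 : fderiv ℝ (fun z => v (φ z)) y = _ := h1.fderiv_eq.trans h2.fderiv
  rw [← h.sum_vecComp_smul_coordVec hy j]
  simp only [map_sum, map_smul, lieIn, pd, h3, coordVec, ContinuousLinearMap.comp_apply]

end IsLocalCoords

/-! ### The Berger metric in coordinates and the algebra of its connection. -/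

theorem vecComp_bergerFrame (a : Fin 3 → ℝ) (φ : E3 → S3) (j α : Fin 3) (z : E3) :
    vecComp φ (bergerFrame a j) α z = 1 / a j * vecComp φ (K j) α z := by
  simp only [vecComp, bergerFrame, inner_smul_right, Finset.mul_sum]
  exact Finset.sum_congr rfl fun β _ => by ring

theorem metricComp_bergerMetric (a : Fin 3 → ℝ) (φ : E3 → S3) (α β : Fin 3) (z : E3) :
    metricComp (bergerMetric a) φ α β z =
      ∑ n, a n ^ 2 * theta φ n α z * theta φ n β z := by
  simp only [metricComp, bergerMetric, coK_coordVec]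

theorem sigmaUp_bergerFrame (a : Fin 3 → ℝ) (φ : E3 → S3) (α : Fin 3) (z : E3) :
    sigmaUp φ (bergerFrame a) α z =
      ∑ m, ((1 / a m * vecComp φ (K m) α z : ℝ) : ℂ) • pauli m := by
  simp only [sigmaUp, vecComp_bergerFrame]

theorem sum_mul_sum_smul {ι κ : Type*} [Fintype ι] [Fintype κ] (f : ι → Fin 3 → ℝ)
    (g : Fin 3 → κ → ℝ) (P : ι → Matrix (Fin 2) (Fin 2) ℂ) (Q : κ → Matrix (Fin 2) (Fin 2) ℂ) :
    ∑ β, (∑ j, (f j β : ℂ) • P j) * (∑ m, (g β m : ℂ) • Q m) =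
      ∑ j, ∑ m, ((∑ β, f j β * g β m : ℝ) : ℂ) • (P j * Q m) := by
  simp only [Finset.sum_mul_sum, smul_mul_smul_comm, Complex.ofReal_sum, Complex.ofReal_mul,
    Finset.sum_smul]
  rw [Finset.sum_comm]
  exact Finset.sum_congr rfl fun j _ => Finset.sum_comm

/-- Contraction of the derivative of `∑ n, A n T n ⊗ T n` with three vectors. -/
theorem contract_deriv_metric (A : Fin 3 → ℝ) (T : Fin 3 → Fin 3 → ℝ)
    (D : Fin 3 → Fin 3 → Fin 3 → ℝ) (u v w : Fin 3 → ℝ) :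
    ∑ α, ∑ γ, ∑ δ, u α * v γ * w δ *
        (∑ n, A n * (D n α γ * T n δ + T n γ * D n α δ)) =
      ∑ n, A n * ((∑ α, ∑ γ, u α * v γ * D n α γ) * (∑ δ, T n δ * w δ) +
        (∑ γ, T n γ * v γ) * (∑ α, ∑ δ, u α * w δ * D n α δ)) := by
  simp only [Finset.mul_sum (s := Finset.univ) (f := fun n => A n * _)]
  rw [Finset.sum_congr rfl fun α _ => Finset.sum_congr rfl fun γ _ => Finset.sum_comm,
    Finset.sum_congr rfl fun α _ => Finset.sum_comm, Finset.sum_comm]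
  refine Finset.sum_congr rfl fun n _ => ?_
  simp only [Fin.sum_univ_three]
  ring

/-- The coefficients of the Levi-Civita connection in the frame `K`. -/
theorem frame_connection {A B : Fin 3 → ℝ} (hAB : ∀ n, A n * B n = 1)
    {T k : Fin 3 → Fin 3 → ℝ} (hTk : ∀ j m, ∑ α, T j α * k α m = if j = m then 1 else 0)
    {D dk dg : Fin 3 → Fin 3 → Fin 3 → ℝ}
    (hdk : ∀ j m α, ∑ β, T j β * dk α β m = -∑ β, D j α β * k β m)
    (hdg : ∀ α γ δ, dg α γ δ = ∑ n, A n * (D n α γ * T n δ + T n γ * D n α δ))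
    (hD : ∀ j p m, (∑ α, ∑ γ, k α p * k γ m * D j α γ) - ∑ α, ∑ γ, k α m * k γ p * D j α γ =
      2 * eps j p m) (j p m : Fin 3) :
    ∑ α, k α p * ∑ β, T j β * (dk α β m + ∑ γ, (1 / 2 * ∑ δ, (∑ n, B n * k β n * k δ n) *
        (dg α γ δ + dg γ α δ - dg δ α γ)) * k γ m) =
      B j * eps j p m * (A p - A j - A m) := by
  have hinv (δ : Fin 3) : ∑ β, T j β * (∑ n, B n * k β n * k δ n) = B j * k δ j := by
    calc ∑ β, T j β * (∑ n, B n * k β n * k δ n)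
        = ∑ n, (∑ β, T j β * k β n) * (B n * k δ n) := by
          simp only [Fin.sum_univ_three]; ring
      _ = B j * k δ j := by simp [hTk]
  -- Only the antisymmetric part of d in its last two indices is known, from `hD`; the symmetric
  -- part must cancel in the end.
  set d : Fin 3 → Fin 3 → Fin 3 → ℝ := fun j p m => ∑ α, ∑ γ, k α p * k γ m * D j α γ with hd
  have hcon (p m j : Fin 3) : ∑ α, ∑ γ, ∑ δ, k α p * k γ m * k δ j * dg α γ δ =
      A j * d j p m + A m * d m p j := by
    simp only [hdg, contract_deriv_metric, hTk]
    simp [mul_add, Finset.sum_add_distrib, hd]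
  have h1 : ∑ α, k α p * ∑ β, T j β * dk α β m = -d j p m := by
    simp only [hdk, hd, mul_neg, Finset.sum_neg_distrib, Finset.mul_sum]
    congr 1
    exact Finset.sum_congr rfl fun α _ => Finset.sum_congr rfl fun γ _ => by ring
  have h2 : ∑ α, k α p * ∑ β, T j β * ∑ γ, (1 / 2 * ∑ δ, (∑ n, B n * k β n * k δ n) *
      (dg α γ δ + dg γ α δ - dg δ α γ)) * k γ m =
      1 / 2 * B j * ∑ α, ∑ γ, ∑ δ, k α p * k γ m * k δ j *
        (dg α γ δ + dg γ α δ - dg δ α γ) := by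
    rw [Finset.mul_sum]
    refine Finset.sum_congr rfl fun α _ => ?_
    calc _ = k α p * ∑ γ, 1 / 2 * k γ m * ∑ δ, (∑ β, T j β * (∑ n, B n * k β n * k δ n)) *
          (dg α γ δ + dg γ α δ - dg δ α γ) := by
          -- The inverse metric is kept opaque, so that expanding the sums stays cheap.
          generalize (fun β δ => ∑ n, B n * k β n * k δ n) = G
          simp only [Fin.sum_univ_three]; ring
      _ = _ := by
          simp only [hinv]
          simp only [Finset.mul_sum]
          exact Finset.sum_congr rfl fun γ _ => Finset.sum_congr rfl fun δ _ => by ring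
  have h3 : ∑ α, ∑ γ, ∑ δ, k α p * k γ m * k δ j * dg γ α δ =
      ∑ α, ∑ γ, ∑ δ, k α m * k γ p * k δ j * dg α γ δ := by
    rw [Finset.sum_comm]
    exact Finset.sum_congr rfl fun α _ => Finset.sum_congr rfl fun γ _ =>
      Finset.sum_congr rfl fun δ _ => by ring
  have h4 : ∑ α, ∑ γ, ∑ δ, k α p * k γ m * k δ j * dg δ α γ =
      ∑ α, ∑ γ, ∑ δ, k α j * k γ p * k δ m * dg α γ δ := by
    rw [Finset.sum_congr rfl fun α _ => Finset.sum_comm, Finset.sum_comm]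
    exact Finset.sum_congr rfl fun α _ => Finset.sum_congr rfl fun γ _ =>
      Finset.sum_congr rfl fun δ _ => by ring
  -- Koszul formula: the three derivatives of the metric give A_j times the symmetric part of d j,
  -- plus antisymmetric differences for m and p. Since A_j B_j = 1, the first of these turns -d j p
  -- m into its antisymmetric half, -ε_{jpm}.
  simp only [mul_add, Finset.sum_add_distrib, mul_sub, Finset.sum_sub_distrib] at h1 h2 ⊢
  rw [h1, h2, h3, h4, hcon, hcon, hcon]
  have e1 : d j p m - d j m p = 2 * eps j p m := hD j p m
  have e2 : d m p j - d m j p = 2 * eps m p j := hD m p j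
  have e3 : d p m j - d p j m = 2 * eps p m j := hD p m j
  have s2 : eps m p j = -eps j p m := by unfold eps; ring
  have s3 : eps p m j = eps j p m := by unfold eps; ring
  rw [s2] at e2
  rw [s3] at e3
  have hB := hAB j
  linear_combination (1 / 2 * (d j p m + d j m p) + eps j p m) * hB - 1 / 2 * e1 +
    1 / 2 * B j * A m * e2 + 1 / 2 * B j * A p * e3

/-- The zero-order term of the Dirac operator. -/
theorem sum_eps_pauli {a : Fin 3 → ℝ} (ha : ∀ j, 0 < a j) :
    ∑ p, ∑ j, ∑ m, ((1 / a p * (1 / a j) * (1 / a m) * eps j p m *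
        (a p ^ 2 - a j ^ 2 - a m ^ 2) : ℝ) : ℂ) • (pauli p * (pauli j * pauli m)) =
      (4 * Complex.I * (nu a : ℂ)) • (1 : Matrix (Fin 2) (Fin 2) ℂ) := by
  have h0 : (a 0 : ℂ) ≠ 0 := by exact_mod_cast (ha 0).ne'
  have h1 : (a 1 : ℂ) ≠ 0 := by exact_mod_cast (ha 1).ne'
  have h2 : (a 2 : ℂ) ≠ 0 := by exact_mod_cast (ha 2).ne'
  -- For distinct indices s^p s^j s^m = i ε_{pjm} = -i ε_{jpm}. The six permutations contribute 2 -
  -- 2 - 2 = -2 times ∑ a_n², giving 2i ∑ a_n² / (a₁a₂a₃).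
  ext q r
  fin_cases q <;> fin_cases r <;>
    simp [Fin.sum_univ_three, eps, pauli, nu, Matrix.sum_apply] <;> field_simp <;> ring_nf

/-! ### The Dirac operator of the Berger metric in arbitrary local coordinates. -/

namespace IsLocalCoords

variable {U : Set E3} {φ : E3 → S3} {y : E3} {a : Fin 3 → ℝ}

theorem sigmaDown_berger (h : IsLocalCoords U φ) (hy : y ∈ U) (ha : ∀ j, 0 < a j) (β : Fin 3) :
    sigmaDown (bergerMetric a) φ (bergerFrame a) β y =
      ∑ j, ((a j * theta φ j β y : ℝ) : ℂ) • pauli j := by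
  simp only [sigmaDown, sigmaUp_bergerFrame, Finset.smul_sum, smul_smul,
    metricComp_bergerMetric, ← Complex.ofReal_mul]
  rw [Finset.sum_comm]
  simp only [← Finset.sum_smul, ← Complex.ofReal_sum]
  refine Finset.sum_congr rfl fun m _ => ?_
  congr 2
  calc _ = ∑ n, a n ^ 2 * theta φ n β y * (1 / a m) *
        ∑ α, theta φ n α y * vecComp φ (K m) α y := by
        simp only [Fin.sum_univ_three]; ring
    _ = _ := by
        simp only [h.sum_theta_mul_vecComp hy]
        have := (ha m).ne'
        simp
        field_simp

/-- The metric matrix is Tᵀ D T with T = θ and D = diag(a_n²), and T⁻¹ has the components of `K` as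
entries. -/
theorem invMetricComp_berger (h : IsLocalCoords U φ) (hy : y ∈ U) (ha : ∀ j, 0 < a j)
    (β δ : Fin 3) :
    invMetricComp (bergerMetric a) φ β δ y =
      ∑ n, (1 / a n) ^ 2 * vecComp φ (K n) β y * vecComp φ (K n) δ y := by
  have hleft : (Matrix.of fun β δ => ∑ n, (1 / a n) ^ 2 * vecComp φ (K n) β y *
      vecComp φ (K n) δ y) * (Matrix.of fun γ δ => metricComp (bergerMetric a) φ γ δ y) = 1 := by
    set T : Matrix (Fin 3) (Fin 3) ℝ := Matrix.of fun j α => theta φ j α y with hT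
    have e1 : (Matrix.of fun γ δ => metricComp (bergerMetric a) φ γ δ y) =
        Tᵀ * Matrix.diagonal (fun n => a n ^ 2) * T := by
      ext γ δ
      simp only [Matrix.of_apply, metricComp_bergerMetric,
        Matrix.mul_apply (M := Tᵀ * _), Matrix.mul_diagonal, Matrix.transpose_apply]
      exact Finset.sum_congr rfl fun n _ => by
        simp only [hT, Matrix.of_apply]
        ring
    have e2 : (Matrix.of fun β δ => ∑ n, (1 / a n) ^ 2 * vecComp φ (K n) β y *
        vecComp φ (K n) δ y) = T⁻¹ * Matrix.diagonal (fun n => (1 / a n) ^ 2) * T⁻¹ᵀ := by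
      ext γ δ
      simp only [Matrix.of_apply, h.vecComp_K hy, Matrix.mul_apply (M := T⁻¹ * _),
        Matrix.mul_diagonal, Matrix.transpose_apply, ← hT]
      exact Finset.sum_congr rfl fun n _ => by ring
    have hu := h.isUnit_det_theta hy
    have e3 : T⁻¹ᵀ * Tᵀ = 1 := by
      rw [← Matrix.transpose_mul, Matrix.mul_nonsing_inv _ hu, Matrix.transpose_one]
    have e4 : Matrix.diagonal (fun n => (1 / a n) ^ 2) * Matrix.diagonal (fun n => a n ^ 2) =
        (1 : Matrix (Fin 3) (Fin 3) ℝ) := by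
      rw [Matrix.diagonal_mul_diagonal, ← Matrix.diagonal_one]
      congr 1
      funext n
      have := (ha n).ne'
      field_simp
    rw [e1, e2]
    calc _ = T⁻¹ * (Matrix.diagonal (fun n => (1 / a n) ^ 2) * (T⁻¹ᵀ * Tᵀ) *
          Matrix.diagonal (fun n => a n ^ 2)) * T := by simp only [Matrix.mul_assoc]
      _ = 1 := by rw [e3, Matrix.mul_one, e4, Matrix.mul_one, Matrix.nonsing_inv_mul _ hu]
  rw [invMetricComp, Matrix.inv_eq_left_inv hleft, Matrix.of_apply]

theorem pd_metricComp_berger (h : IsLocalCoords U φ) (hy : y ∈ U) (α γ δ : Fin 3) :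
    pd α (metricComp (bergerMetric a) φ γ δ) y =
      ∑ n, a n ^ 2 * (pd α (theta φ n γ) y * theta φ n δ y +
        theta φ n γ y * pd α (theta φ n δ) y) := by
  have h1 := HasFDerivAt.fun_sum fun n (_ : n ∈ Finset.univ) =>
    ((h.differentiableAt_theta hy n γ).hasFDerivAt.const_mul (a n ^ 2)).mul
      (h.differentiableAt_theta hy n δ).hasFDerivAt
  rw [pd, show metricComp (bergerMetric a) φ γ δ = _ from
    funext fun z => metricComp_bergerMetric a φ γ δ z]
  refine (DFunLike.congr_fun (HasFDerivAt.fderiv h1) (EuclideanSpace.single α 1)).trans ?_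
  simp only [sum_apply, add_apply, smul_apply, smul_eq_mul, pd]
  exact Finset.sum_congr rfl fun n _ => by ring

theorem pdSigma_berger (h : IsLocalCoords U φ) (hy : y ∈ U) (α β : Fin 3) :
    pdSigma φ (bergerFrame a) α β y =
      ∑ m, ((1 / a m * pd α (vecComp φ (K m) β) y : ℝ) : ℂ) • pauli m := by
  ext p q
  have h1 := HasFDerivAt.fun_sum fun m (_ : m ∈ Finset.univ) =>
    (Complex.ofRealCLM.hasFDerivAt.comp y
      ((h.differentiableAt_vecComp_K hy m β).hasFDerivAt.const_mul (1 / a m))).mul_const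
        (pauli m p q)
  have h2 : (fun z => sigmaUp φ (bergerFrame a) β z p q) =
      fun z => ∑ m, ((1 / a m * vecComp φ (K m) β z : ℝ) : ℂ) * pauli m p q := by
    funext z
    simp only [sigmaUp_bergerFrame, Matrix.sum_apply, Matrix.smul_apply, smul_eq_mul]
  rw [pdSigma, Matrix.of_apply, pd, h2]
  refine (DFunLike.congr_fun (HasFDerivAt.fderiv h1) (EuclideanSpace.single α 1)).trans ?_
  simp [Matrix.sum_apply, pd, mul_comm]

/-- The zero-order term of the Dirac operator is multiplication by a constant. -/
theorem sum_sigma_connection (h : IsLocalCoords U φ) (hy : y ∈ U) (ha : ∀ j, 0 < a j) :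
    ∑ α, sigmaUp φ (bergerFrame a) α y *
      ∑ β, sigmaDown (bergerMetric a) φ (bergerFrame a) β y *
        (pdSigma φ (bergerFrame a) α β y + ∑ γ, (christoffel (bergerMetric a) φ β α γ y : ℂ) •
          sigmaUp φ (bergerFrame a) γ y) =
      (4 * Complex.I * (nu a : ℂ)) • (1 : Matrix (Fin 2) (Fin 2) ℂ) := by
  have h1 (α β : Fin 3) : pdSigma φ (bergerFrame a) α β y +
      ∑ γ, (christoffel (bergerMetric a) φ β α γ y : ℂ) • sigmaUp φ (bergerFrame a) γ y =
      ∑ m, ((1 / a m * (pd α (vecComp φ (K m) β) y +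
        ∑ γ, christoffel (bergerMetric a) φ β α γ y * vecComp φ (K m) γ y) : ℝ) : ℂ) •
          pauli m := by
    simp only [h.pdSigma_berger hy, sigmaUp_bergerFrame, Finset.smul_sum, smul_smul,
      ← Complex.ofReal_mul]
    rw [Finset.sum_comm, ← Finset.sum_add_distrib]
    simp only [← Finset.sum_smul, ← Complex.ofReal_sum, ← add_smul, ← Complex.ofReal_add]
    refine Finset.sum_congr rfl fun m _ => ?_
    rw [mul_add, Finset.mul_sum]
    congr 4
    funext γ
    ring
  have h2 (α : Fin 3) := sum_mul_sum_smul (fun j β => a j * theta φ j β y)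
    (fun β m => 1 / a m * (pd α (vecComp φ (K m) β) y +
        ∑ γ, christoffel (bergerMetric a) φ β α γ y * vecComp φ (K m) γ y)) pauli pauli
  beta_reduce at h2
  simp only [h1]
  simp only [h.sigmaDown_berger hy ha]
  simp only [h2, sigmaUp_bergerFrame]
  -- The pair (j, m) is treated as one index, so that `sum_mul_sum_smul` applies a second time, to
  -- the product with σ^α.
  simp only [← Fintype.sum_prod_type']
  rw [sum_mul_sum_smul (fun p α => 1 / a p * vecComp φ (K p) α y)
    (fun α (jm : Fin 3 × Fin 3) => ∑ β, a jm.1 * theta φ jm.1 β y *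
      (1 / a jm.2 * (pd α (vecComp φ (K jm.2) β) y +
        ∑ γ, christoffel (bergerMetric a) φ β α γ y * vecComp φ (K jm.2) γ y))) pauli
    (fun jm => pauli jm.1 * pauli jm.2), ← sum_eps_pauli ha]
  simp only [Fintype.sum_prod_type]
  refine Finset.sum_congr rfl fun p _ => Finset.sum_congr rfl fun j _ =>
    Finset.sum_congr rfl fun m _ => ?_
  congr 2
  have hAB (n : Fin 3) : a n ^ 2 * (1 / a n) ^ 2 = 1 := by
    have := (ha n).ne'
    field_simp
  have h3 := frame_connection (A := fun n => a n ^ 2) (B := fun n => (1 / a n) ^ 2) hAB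
    (T := fun j α => theta φ j α y) (k := fun α m => vecComp φ (K m) α y)
    (D := fun j α γ => pd α (theta φ j γ) y) (dk := fun α β m => pd α (vecComp φ (K m) β) y)
    (h.sum_theta_mul_vecComp hy) (h.sum_theta_mul_pd_vecComp hy)
    (h.pd_metricComp_berger hy) (h.sum_pd_theta_sub hy) j p m
  simp only [← h.invMetricComp_berger hy ha] at h3
  have h4 : 1 / a p * (1 / a j) * (1 / a m) * eps j p m * (a p ^ 2 - a j ^ 2 - a m ^ 2) =
      1 / a p * a j * (1 / a m) * ((1 / a j) ^ 2 * eps j p m * (a p ^ 2 - a j ^ 2 - a m ^ 2)) := by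
    have := (ha j).ne'
    field_simp
  rw [h4, ← h3, Finset.mul_sum]
  refine Finset.sum_congr rfl fun α _ => ?_
  simp only [Finset.mul_sum, christoffel]
  refine Finset.sum_congr rfl fun β _ => ?_
  ring

/-- The zero-order constant is (-i) · ¼ · 4iν = ν. The first-order part is a linear regrouping of
partial derivatives, so no smoothness of v is needed. -/
theorem diracIn_berger (h : IsLocalCoords U φ) (hy : y ∈ U) (ha : ∀ j, 0 < a j)
    (v : SpinorField) :
    diracIn (bergerMetric a) (bergerFrame a) φ v y =
      (-Complex.I) • (∑ j, ((1 / a j : ℝ) : ℂ) • (pauli j).mulVec (lieIn (K j) φ v y)) +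
        (nu a : ℂ) • v (φ y) := by
  have h1 : ∑ α, sigmaUp φ (bergerFrame a) α y *ᵥ pd α (fun z => v (φ z)) y =
      ∑ j, ((1 / a j : ℝ) : ℂ) • (pauli j).mulVec (lieIn (K j) φ v y) := by
    simp only [sigmaUp_bergerFrame, lieIn, Matrix.sum_mulVec, Matrix.mulVec_sum,
      Matrix.smul_mulVec, Matrix.mulVec_smul, Finset.smul_sum]
    rw [Finset.sum_comm]
    refine Finset.sum_congr rfl fun j _ => Finset.sum_congr rfl fun α _ => ?_
    rw [Complex.ofReal_mul, mul_smul, Complex.coe_smul (vecComp _ _ _ _)]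
  rw [diracIn]
  simp only [Matrix.mulVec_add, Matrix.mulVec_smul, Matrix.mulVec_mulVec,
    Finset.sum_add_distrib, h1, smul_add, ← Finset.smul_sum, ← Matrix.sum_mulVec,
    h.sum_sigma_connection hy ha, Matrix.smul_mulVec, Matrix.one_mulVec, smul_smul]
  congr 2
  linear_combination (-(nu a : ℂ)) * Complex.I_mul_I

end IsLocalCoords

/-! ### The global operators and the frame. -/

theorem lie_K_eq {v : SpinorField} {x : S3} {V : E4 → Spin2}
    (hV : DifferentiableAt ℝ V (x : E4)) (hvV : ∀ᶠ q in nhds x, v q = V (q : E4)) (j : Fin 3) :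
    L j v x = fderiv ℝ V (x : E4) (K j x) := by
  have hx : (chartAt E3 x).symm (chartAt E3 x x) = x :=
    (chartAt E3 x).left_inv (mem_chart_source E3 x)
  have := (isLocalCoords_chart x).lieIn_K_eq (Set.mem_univ (chartAt E3 x x)) j (v := v) (V := V)
    (by rwa [hx]) (by rwa [hx])
  rwa [hx] at this

theorem L_eq_lieIn {v : SpinorField} (hv : SmoothSpinor v) {U : Set E3} {φ : E3 → S3}
    (h : IsLocalCoords U φ) {y : E3} (hy : y ∈ U) (j : Fin 3) :
    L j v (φ y) = lieIn (K j) φ v y := by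
  obtain ⟨V, hV, hvV⟩ := hv.exists_ambient (φ y)
  rw [lie_K_eq hV hvV, h.lieIn_K_eq hy j hV hvV]

theorem bergerDirac_eq {a : Fin 3 → ℝ} (ha : ∀ j, 0 < a j) (v : SpinorField) (x : S3) :
    bergerDirac a v x =
      (-Complex.I) • (∑ j, ((1 / a j : ℝ) : ℂ) • (pauli j).mulVec (L j v x)) +
        (nu a : ℂ) • v x := by
  have hx : (chartAt E3 x).symm (chartAt E3 x x) = x :=
    (chartAt E3 x).left_inv (mem_chart_source E3 x)
  have := (isLocalCoords_chart x).diracIn_berger (Set.mem_univ (chartAt E3 x x)) ha v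
  rwa [hx] at this

theorem isOrthonormalFrame_berger {a : Fin 3 → ℝ} (ha : ∀ j, 0 < a j) :
    IsOrthonormalFrame (bergerMetric a) (bergerFrame a) := by
  refine ⟨fun j x => ?_, fun j k x => ?_⟩
  · rw [bergerFrame, inner_smul_right, K_eq_linK, inner_linK_self, mul_zero]
  · simp only [bergerMetric, bergerFrame, coK, inner_smul_right, inner_K_K]
    by_cases h : j = k
    · subst h
      have := (ha j).ne'
      simp
      field_simp
    · simp [h, Ne.symm h]

/-- The determinant equals |x|⁴ / (a₁a₂a₃). -/
theorem isPositiveFrame_berger {a : Fin 3 → ℝ} (ha : ∀ j, 0 < a j) :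
    IsPositiveFrame (bergerFrame a) := by
  intro x
  have h1 := inner_S3_self x
  rw [inner_E4] at h1
  have h2 : (Matrix.of ![fun i => (x : E4) i, fun i => bergerFrame a 0 x i,
      fun i => bergerFrame a 1 x i, fun i => bergerFrame a 2 x i]).det =
      1 / a 0 * (1 / a 1) * (1 / a 2) * ((x : E4) 0 * (x : E4) 0 + (x : E4) 1 * (x : E4) 1 +
        (x : E4) 2 * (x : E4) 2 + (x : E4) 3 * (x : E4) 3) ^ 2 := by
    simp [Matrix.det_succ_row_zero, Fin.sum_univ_succ, bergerFrame, K, Fin.succAbove]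
    ring
  rw [h2, h1]
  have := ha 0
  have := ha 1
  have := ha 2
  positivity

/-! ### Spinors linear in the Cartesian coordinates -/

/-- The linear extension of `linSpinor c` to `ℝ⁴`. -/
def linExt (c : Fin 4 × Fin 2 → ℂ) : E4 →L[ℝ] Spin2 :=
  LinearMap.toContinuousLinearMap
    { toFun := fun x p => ∑ i, c (i, p) * ((x i : ℝ) : ℂ)
      map_add' := fun x y => by
        funext p
        simp [mul_add, Finset.sum_add_distrib]
      map_smul' := fun r x => by
        funext p
        simp only [PiLp.smul_apply, smul_eq_mul, Complex.ofReal_mul, RingHom.id_apply,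
          Pi.smul_apply, Complex.real_smul, Finset.mul_sum]
        exact Finset.sum_congr rfl fun i _ => by ring }

theorem linExt_apply (c : Fin 4 × Fin 2 → ℂ) (x : E4) (p : Fin 2) :
    linExt c x p = ∑ i, c (i, p) * ((x i : ℝ) : ℂ) := rfl

theorem L_linSpinor (c : Fin 4 × Fin 2 → ℂ) (j : Fin 3) (x : S3) :
    L j (linSpinor c) x = linExt c (K j x) := by
  rw [lie_K_eq (v := linSpinor c) (V := linExt c) (linExt c).differentiableAt (Filter.Eventually.of_forall
    fun _ => rfl), ContinuousLinearMap.fderiv]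

theorem smoothSpinor_linSpinor (c : Fin 4 × Fin 2 → ℂ) : SmoothSpinor (linSpinor c) := by
  have : Fact (Module.finrank ℝ E4 = 3 + 1) := ⟨finrank_euclideanSpace_fin⟩
  exact (linExt c).contDiff.contMDiff.comp (contMDiff_coe_sphere (n := 3))

theorem linSpinor_injective : Function.Injective linSpinor := by
  intro c c' h
  funext ⟨i, p⟩
  -- The standard basis vectors lie on the sphere, and the values there are the coefficients.
  have := congrFun (congrFun h ⟨EuclideanSpace.single i 1, by simp⟩) p
  simpa [linSpinor, Pi.single_apply, apply_ite] using this

/-- The matrices of the linear vector fields `linK`. -/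
def matK : Fin 3 → Matrix (Fin 4) (Fin 4) ℂ :=
  ![!![0, 0, 0, -1; 0, 0, -1, 0; 0, 1, 0, 0; 1, 0, 0, 0],
    !![0, 0, 1, 0; 0, 0, 0, -1; -1, 0, 0, 0; 0, 1, 0, 0],
    !![0, -1, 0, 0; 1, 0, 0, 0; 0, 0, 0, -1; 0, 0, 1, 0]]

theorem ofReal_K_apply (j : Fin 3) (x : S3) (i : Fin 4) :
    ((K j x i : ℝ) : ℂ) = ∑ k, matK j i k * (((x : E4) k : ℝ) : ℂ) := by
  fin_cases j <;> fin_cases i <;> simp [K, matK, Fin.sum_univ_four]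

/-- The matrix `ν + i ∑ j, b_j K_j ⊗ s_j`. -/
def linMatrix (ν : ℝ) (b : Fin 3 → ℝ) : Matrix (Fin 4 × Fin 2) (Fin 4 × Fin 2) ℂ :=
  Matrix.of fun s t => (if s = t then (ν : ℂ) else 0) +
    Complex.I * ∑ j, (b j : ℂ) * matK j s.1 t.1 * pauli j s.2 t.2

theorem matK_transpose (j : Fin 3) (i k : Fin 4) : matK j k i = -matK j i k := by
  fin_cases j <;> fin_cases i <;> fin_cases k <;> simp [matK]

theorem star_matK (j : Fin 3) (i k : Fin 4) : star (matK j i k) = matK j i k := by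
  fin_cases j <;> fin_cases i <;> fin_cases k <;> simp [matK]

theorem star_pauli (j : Fin 3) (p q : Fin 2) : star (pauli j q p) = pauli j p q := by
  fin_cases j <;> fin_cases p <;> fin_cases q <;> simp [pauli]

/-- Each K_j is real and skew, so i K_j ⊗ s_j is Hermitian. -/
theorem isHermitian_linMatrix (ν : ℝ) (b : Fin 3 → ℝ) : (linMatrix ν b).IsHermitian := by
  ext s t
  have h1 : star (if t = s then (ν : ℂ) else 0) = if s = t then (ν : ℂ) else 0 := by
    by_cases h : s = t <;> simp [h, eq_comm]
  simp only [Matrix.conjTranspose_apply, linMatrix, Matrix.of_apply, star_add, h1, star_mul,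
    star_sum, star_pauli, matK_transpose _ s.1 t.1]
  simp only [mul_neg, neg_mul, Finset.sum_neg_distrib, star_neg, star_matK, Complex.star_def,
    Complex.conj_I, Complex.conj_ofReal, neg_neg, Finset.mul_sum, Finset.sum_mul]
  congr 1
  exact Finset.sum_congr rfl fun j _ => by ring

theorem bergerDirac_linSpinor {a : Fin 3 → ℝ} (ha : ∀ j, 0 < a j) (c : Fin 4 × Fin 2 → ℂ) :
    bergerDirac a (linSpinor c) =
      linSpinor ((linMatrix (nu a) fun j => 1 / a j).mulVec c) := by
  funext x p
  rw [bergerDirac_eq ha]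
  simp only [L_linSpinor, linSpinor, Pi.add_apply, Pi.smul_apply, Finset.sum_apply, smul_eq_mul,
    Matrix.mulVec, dotProduct, linExt_apply, ofReal_K_apply, linMatrix, Matrix.of_apply,
    add_mul, Finset.sum_add_distrib, ite_mul, zero_mul, Finset.sum_ite_eq, Finset.mem_univ,
    if_true, Fintype.sum_prod_type]
  rw [add_comm]
  congr 1
  · simp only [Finset.mul_sum, mul_assoc]
  · simp only [Finset.mul_sum, Finset.sum_mul]
    calc _ = ∑ j, ∑ q, ∑ k, ∑ i, Complex.I * ((1 / a j : ℝ) : ℂ) * matK j i k * pauli j p q *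
          c (k, q) * (((x : E4) i : ℝ) : ℂ) := by
          refine Finset.sum_congr rfl fun j _ => Finset.sum_congr rfl fun q _ =>
            Finset.sum_congr rfl fun k _ => Finset.sum_congr rfl fun i _ => ?_
          -- Coefficients transform by the transpose of K_j; skewness turns the factor -i into i.
          rw [matK_transpose j k i]
          ring
      _ = ∑ i, ∑ k, ∑ q, ∑ j, Complex.I * ((1 / a j : ℝ) : ℂ) * matK j i k * pauli j p q *
          c (k, q) * (((x : E4) i : ℝ) : ℂ) := by
          simp only [Fin.sum_univ_two, Fin.sum_univ_three, Fin.sum_univ_four]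
          ring
      _ = _ := by
          refine Finset.sum_congr rfl fun i _ => Finset.sum_congr rfl fun k _ =>
            Finset.sum_congr rfl fun q _ => Finset.sum_congr rfl fun j _ => ?_
          ring

/-- The signs of the `b_j` in the eigenvalues of `linMatrix`. -/
def signs : Fin 4 → Fin 3 → ℂ :=
  ![![-1, -1, -1], ![-1, 1, 1], ![1, -1, 1], ![1, 1, -1]]

/-- A matrix of eigenvectors of `linMatrix`. -/
def eigMatrix : Matrix (Fin 4 × Fin 2) (Fin 4 × Fin 2) ℂ :=
  Matrix.of fun s t => (![(1 : Matrix (Fin 2) (Fin 2) ℂ), (Complex.I * signs t.1 2) • pauli 2,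
    -(Complex.I * signs t.1 1) • pauli 1, (Complex.I * signs t.1 0) • pauli 0] s.1) s.2 t.2

set_option maxHeartbeats 2000000 in
-- With S_j = i K_j ⊗ s_j, the projection onto the joint eigenspace with signs ε_j is ¼(1 + ∑ ε_j
-- S_j), because S₁S₂ = -S₃ and ε₁ε₂ = -ε₃. The columns of `eigMatrix` are four times the
-- projections of e₀ ⊗ w, with w running over the standard basis of ℂ².
theorem linMatrix_mul_eigMatrix (ν : ℝ) (b : Fin 3 → ℝ) :
    linMatrix ν b * eigMatrix = eigMatrix *
      Matrix.diagonal fun t => (ν : ℂ) + ∑ j, signs t.1 j * (b j : ℂ) := by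
  ext ⟨i, p⟩ ⟨k, q⟩
  rw [Matrix.mul_diagonal, Matrix.mul_apply, Fintype.sum_prod_type]
  simp only [Fin.sum_univ_two, Fin.sum_univ_three, Fin.sum_univ_four, linMatrix, eigMatrix,
    Matrix.of_apply]
  fin_cases i <;> fin_cases p <;> fin_cases k <;> fin_cases q <;>
    simp [matK, pauli, signs] <;> ring_nf <;> simp <;> ring

/-- The sign triples extended by a leading 1 form a 4 × 4 Hadamard matrix. -/
theorem eigMatrix_mul_conjTranspose :
    eigMatrix * eigMatrixᴴ = (4 : ℂ) • 1 := by
  ext ⟨i, p⟩ ⟨k, q⟩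
  rw [Matrix.mul_apply, Fintype.sum_prod_type]
  simp only [Fin.sum_univ_two, Fin.sum_univ_four, eigMatrix, Matrix.of_apply,
    Matrix.conjTranspose_apply]
  fin_cases i <;> fin_cases p <;> fin_cases k <;> fin_cases q <;>
    simp [pauli, signs] <;> norm_num

/-- Similarity to the diagonal matrix of eigenvalues, which do not depend on the index of w in ℂ²;
hence the square. -/
theorem charpoly_linMatrix (ν : ℝ) (b : Fin 3 → ℝ) :
    (linMatrix ν b).charpoly = (∏ k, (Polynomial.X -
      Polynomial.C ((ν : ℂ) + ∑ j, signs k j * (b j : ℂ)))) ^ 2 := by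
  have h1 : eigMatrix * ((1 / 4 : ℂ) • eigMatrixᴴ) = 1 := by
    rw [Matrix.mul_smul, eigMatrix_mul_conjTranspose, smul_smul]
    norm_num
  have h2 := mul_eq_one_comm.1 h1
  have h3 : linMatrix ν b = eigMatrix * ((Matrix.diagonal fun t : Fin 4 × Fin 2 =>
      (ν : ℂ) + ∑ j, signs t.1 j * (b j : ℂ)) * ((1 / 4 : ℂ) • eigMatrixᴴ)) := by
    rw [← Matrix.mul_assoc, ← linMatrix_mul_eigMatrix, Matrix.mul_assoc, h1, Matrix.mul_one]
  rw [h3, Matrix.charpoly_mul_comm, Matrix.mul_assoc, h2, Matrix.mul_one,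
    Matrix.charpoly_diagonal, Fintype.prod_prod_type]
  simp only [Finset.prod_const, Finset.prod_pow]
  rfl

theorem ofReal_linEigenvalue (a : Fin 3 → ℝ) (k : Fin 4) :
    ((linEigenvalue a k : ℝ) : ℂ) =
      (nu a : ℂ) + ∑ j, signs k j * ((1 / a j : ℝ) : ℂ) := by
  fin_cases k <;> simp [linEigenvalue, signs, Fin.sum_univ_three] <;> ring

theorem charpoly_linMatrix_berger (a : Fin 3 → ℝ) :
    (linMatrix (nu a) fun j => 1 / a j).charpoly =
      (∏ k, (Polynomial.X - Polynomial.C ((linEigenvalue a k : ℝ) : ℂ))) ^ 2 := by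
  simp only [charpoly_linMatrix, ofReal_linEigenvalue]

theorem exists_isEigenspinor_linSpinor_iff {a : Fin 3 → ℝ} (ha : ∀ j, 0 < a j) (μ : ℂ) :
    (∃ c, IsEigenspinor (bergerDirac a) μ (linSpinor c)) ↔
      ∃ k, μ = ((linEigenvalue a k : ℝ) : ℂ) := by
  have h0 : linSpinor 0 = 0 := by
    funext x p
    simp [linSpinor]
  have hsmul (c : Fin 4 × Fin 2 → ℂ) : μ • linSpinor c = linSpinor (μ • c) := by
    funext x p
    simp [linSpinor, Finset.mul_sum, mul_assoc]
  have h1 (c : Fin 4 × Fin 2 → ℂ) : IsEigenspinor (bergerDirac a) μ (linSpinor c) ↔ c ≠ 0 ∧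
      (Matrix.scalar _ μ - linMatrix (nu a) fun j => 1 / a j) *ᵥ c = 0 := by
    rw [IsEigenspinor, bergerDirac_linSpinor ha, hsmul, linSpinor_injective.eq_iff, ← h0,
      linSpinor_injective.ne_iff, Matrix.sub_mulVec, sub_eq_zero, Matrix.scalar_apply,
      ← Matrix.smul_one_eq_diagonal, Matrix.smul_mulVec, Matrix.one_mulVec, eq_comm (a := μ • c)]
    simp only [smoothSpinor_linSpinor, true_and]
  simp only [h1]
  -- As `linSpinor` is injective, μ is an eigenvalue exactly when it is a root of the characteristic
  -- polynomial.
  rw [Matrix.exists_mulVec_eq_zero_iff, ← Matrix.eval_charpoly, charpoly_linMatrix_berger]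
  simp [Polynomial.eval_prod, Finset.prod_eq_zero_iff, sub_eq_zero]

theorem L_const (c : Spin2) (j : Fin 3) (x : S3) : L j (fun _ => c) x = 0 := by
  rw [lie_K_eq (V := fun _ => c) (differentiableAt_const c) (Filter.Eventually.of_forall
    fun _ => rfl)]
  simp

theorem isEigenspinor_const {a : Fin 3 → ℝ} (ha : ∀ j, 0 < a j) {c : Spin2} (hc : c ≠ 0) :
    IsEigenspinor (bergerDirac a) (nu a : ℂ) (fun _ => c) := by
  refine ⟨contMDiff_const, fun h => hc ?_, ?_⟩
  · exact congrFun h ⟨EuclideanSpace.single 0 1, by simp⟩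
  · funext x
    rw [bergerDirac_eq ha]
    simp [L_const]

end Berger

end

theorem mainTheorem3 (a : Fin 3 → ℝ) (ha : ∀ j, 0 < a j) :
    -- the fields `K_j / a_j` form a positively oriented orthonormal frame
    Berger.IsOrthonormalFrame (Berger.bergerMetric a) (Berger.bergerFrame a) ∧
    Berger.IsPositiveFrame (Berger.bergerFrame a) ∧
    -- the formula for the Dirac operator, in arbitrary local coordinates
    (∀ v : Berger.SpinorField, Berger.SmoothSpinor v →
      ∀ (U : Set Berger.E3) (φ : Berger.E3 → Berger.S3), Berger.IsLocalCoords U φ → ∀ y ∈ U,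
        Berger.bergerDirac a v (φ y) =
            Berger.diracIn (Berger.bergerMetric a) (Berger.bergerFrame a) φ v y ∧
        (∀ j, Berger.L j v (φ y) = Berger.lieIn (Berger.K j) φ v y)) ∧
    (∀ v : Berger.SpinorField, Berger.SmoothSpinor v → ∀ x : Berger.S3,
      Berger.bergerDirac a v x =
        (-Complex.I) • (∑ j, ((1 / a j : ℝ) : ℂ) • (Berger.pauli j).mulVec (Berger.L j v x)) +
          (Berger.nu a : ℂ) • v x) ∧
    -- the nonzero constant spinors are eigenspinors for the eigenvalue `ν`
    (∀ c : Berger.Spin2, c ≠ 0 →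
      Berger.IsEigenspinor (Berger.bergerDirac a) (Berger.nu a : ℂ) (fun _ => c)) ∧
    -- on spinors linear in the Cartesian coordinates, the Dirac operator is an `8 × 8` Hermitian
    -- matrix, with characteristic polynomial the square of a polynomial with the four given roots
    (∃ M : Matrix (Fin 4 × Fin 2) (Fin 4 × Fin 2) ℂ, M.IsHermitian ∧
      (∀ c : Fin 4 × Fin 2 → ℂ,
        Berger.bergerDirac a (Berger.linSpinor c) = Berger.linSpinor (M.mulVec c)) ∧
      M.charpoly =
        (∏ k, (Polynomial.X - Polynomial.C ((Berger.linEigenvalue a k : ℝ) : ℂ))) ^ 2) ∧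
    -- the eigenvalues with an eigenspinor linear in the Cartesian coordinates
    (∀ μ : ℂ, (∃ c : Fin 4 × Fin 2 → ℂ,
        Berger.IsEigenspinor (Berger.bergerDirac a) μ (Berger.linSpinor c)) ↔
      ∃ k, μ = ((Berger.linEigenvalue a k : ℝ) : ℂ)) := by
  refine ⟨Berger.isOrthonormalFrame_berger ha, Berger.isPositiveFrame_berger ha,
    fun v hv U φ h y hy => ⟨?_, fun j => Berger.L_eq_lieIn hv h hy j⟩,
    fun v _ x => Berger.bergerDirac_eq ha v x, fun c hc => Berger.isEigenspinor_const ha hc,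
    ⟨_, Berger.isHermitian_linMatrix _ _, Berger.bergerDirac_linSpinor ha,
      Berger.charpoly_linMatrix_berger a⟩,
    fun μ => Berger.exists_isEigenspinor_linSpinor_iff ha μ⟩
  rw [Berger.bergerDirac_eq ha, h.diracIn_berger hy ha]
  simp only [Berger.L_eq_lieIn hv h hy]
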